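/- A planted plane tree is a finite rooted tree in which each vertex has an arbitrary finite number of children and the children of each vertex are linearly ordered from left to right. Let $\mathcal T_n$ be the (finite) set of planted plane trees with $n$ vertices. An embedding of a planted plane tree $S$ into a planted plane tree $T$ is a set $A$ of vertices of $T$ which, with the ancestor order of $T$, is isomorphic to the poset of vertices of $S$ by an isomorphism that respects the left-to-right order of the children of each vertex of $S$; it is good if $A$ contains the root of $T$. Let $a_T(S)$ and $g_T(S)$ be the numbers of all embeddings and of good embeddings of $S$ into $T$, and put $$a_{\mathcal T_n}(S)=\sum_{T\in\mathcal T_n}a_T(S),\qquad g_{\mathcal T_n}(S)=\sum_{T\in\mathcal T_n}g_T(S).$$ **Theorem.** Let $S$ be a planted plane tree with $m\ge 1$ vertices, let $d_i$ be the number of its vertices with exactly $i$ children, let $l=d_0$ be the number of its leaves, and let $C=\prod_{i=1}^{m-1}\boldsymbol C_{i-1}^{\,d_i}$, where $\boldsymbol C_k=\frac1{k+1}\binom{2k}{k}$. Then, as $n\to\infty$, $$a_{\mathcal T_n}(S)\sim\frac{C\cdot(1/2)^{m+l}}{\Gamma\left(\frac{m+l-1}{2}\right)}\cdot 4^n\cdot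 n^{\frac{m+l-3}{2}}.$$ If $m\ge 2$, then $$g_{\mathcal T_n}(S)\sim\frac{2C\cdot(1/2)^{m+l}}{\Gamma\left(\frac{m+l-2}{2}\right)}\cdot 4^n\cdot n^{\frac{m+l-4}{2}},$$ and if $m=1$ (that is, $S$ is a single vertex), then $$g_{\mathcal T_n}(S)\sim\frac{1}{4\sqrt{\pi}}\cdot 4^n\cdot n^{-3/2}.$$ -/

import Mathlib

open Filter Asymptotics

/-- Planted plane trees (Catalan trees): a root together with the finite, possibly empty, ordered
list of the subtrees attached to it, listed from left to right. -/
inductive PlaneTree : Type where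
  | node : List PlaneTree → PlaneTree

namespace PlaneTree

/-- The size of a tree, that is, its number of vertices. -/
def size : PlaneTree → ℕ
  | node ts => 1 + (ts.map size).sum

/-- `T.degreeCount i` is the number `d_i` of vertices of `T` whose out-degree (number of
children) is equal to `i`. In particular `T.degreeCount 0` is the number of leaves. -/
def degreeCount (i : ℕ) : PlaneTree → ℕ
  | node ts => (if ts.length = i then 1 else 0) + (ts.map (degreeCount i)).sum

/-- The vertices of a tree, named by their addresses: `[]` is the root, and `i :: p` is the vertex
with address `p` inside the `i`-th subtree (counted from `0`, from left to right) attached to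
the root. -/
inductive IsVertex : PlaneTree → List ℕ → Prop where
  | root (T : PlaneTree) : IsVertex T []
  | child {ts : List PlaneTree} {i : ℕ} {t : PlaneTree} {p : List ℕ} :
      ts[i]? = some t → IsVertex t p → IsVertex (node ts) (i :: p)

/-- The set of all (addresses of) vertices of a tree. A vertex `u` is an ancestor of `v`, or equal
to `v`, exactly when the address `u` is a prefix of the address `v`, written `u <+: v`; this is the
tree order, with the root as maximal element. -/
def vertices (T : PlaneTree) : Set (List ℕ) := {p | T.IsVertex p}

/-- `LeftOf u v`: below some common ancestor `p`, the vertex `u` lies in (the subtree rooted at) a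
child of `p` that is strictly to the left of the child of `p` below which `v` lies. -/
def LeftOf (u v : List ℕ) : Prop :=
  ∃ (p : List ℕ) (i j : ℕ), i < j ∧ (p ++ [i]) <+: u ∧ (p ++ [j]) <+: v

/-- `A` is (the vertex set of) an embedding of the plane tree `S` into the plane tree `T`: a
subposet of `T` that is isomorphic to the poset `S`, by an isomorphism for which the left-to-right
order of the children of each node of `S` is inherited from `T`. -/
def IsEmbedding (S T : PlaneTree) (A : Set (List ℕ)) : Prop :=
  A ⊆ T.vertices ∧
    ∃ φ : List ℕ → List ℕ, Set.BijOn φ S.vertices A ∧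
      (∀ u ∈ S.vertices, ∀ v ∈ S.vertices, (u <+: v ↔ φ u <+: φ v)) ∧
      (∀ (u : List ℕ) (i j : ℕ), u ++ [i] ∈ S.vertices → u ++ [j] ∈ S.vertices → i < j →
        LeftOf (φ (u ++ [i])) (φ (u ++ [j])))

/-- The number `a_T(S)` of all embeddings of `S` into `T`. -/
noncomputable def embCount (T S : PlaneTree) : ℕ :=
  {A : Set (List ℕ) | IsEmbedding S T A}.ncard

/-- The number `g_T(S)` of good embeddings of `S` into `T`: those that contain the root of `T`. -/
noncomputable def goodEmbCount (T S : PlaneTree) : ℕ :=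
  {A : Set (List ℕ) | IsEmbedding S T A ∧ [] ∈ A}.ncard

theorem finite_vertices : ∀ T : PlaneTree, T.vertices.Finite
  | node ts => by
    have h : (node ts).vertices ⊆ {[]} ∪ ⋃ t ∈ {t | t ∈ ts}, ⋃ i ∈ Set.Iio ts.length,
        (fun p => i :: p) '' t.vertices := by
      intro p hp
      cases hp with
      | root => simp
      | @child _ i t q h1 h2 =>
        right
        obtain ⟨hi, rfl⟩ := List.getElem?_eq_some_iff.mp h1
        simp only [Set.mem_iUnion]
        exact ⟨ts[i], List.getElem_mem hi, i, hi, q, h2, rfl⟩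
    refine Set.Finite.subset ((Set.finite_singleton _).union ?_) h
    refine Set.Finite.biUnion (List.finite_toSet ts) fun t ht => ?_
    exact Set.Finite.biUnion (Set.finite_Iio _) fun i _ => (finite_vertices t).image _
termination_by T => sizeOf T
decreasing_by
  have := List.sizeOf_lt_of_mem ht
  simp only [node.sizeOf_spec]
  omega

/-- Both counts are counts of elements of finite sets. -/
theorem finite_embeddings (T S : PlaneTree) : {A : Set (List ℕ) | IsEmbedding S T A}.Finite :=
  (finite_vertices T).finite_subsets.subset fun _ h => h.1

theorem finite_size_le (n : ℕ) : {T : PlaneTree | T.size ≤ n}.Finite := by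
  induction n with
  | zero =>
    convert Set.finite_empty
    ext T
    cases T
    simp [size]
  | succ n ih =>
    have : Finite {T : PlaneTree // T.size ≤ n} := ih
    refine ((List.finite_length_le {T : PlaneTree // T.size ≤ n} n).image
      fun l => node (l.map Subtype.val)).subset ?_
    rintro ⟨ts⟩ h
    have h' : (ts.map size).sum ≤ n := by
      have h0 : 1 + (ts.map size).sum ≤ n + 1 := by
        simpa only [Set.mem_ofPred_eq, size] using h
      omega
    have hm : ∀ t ∈ ts, t.size ≤ n := fun t ht =>
      (List.single_le_sum (by simp) _ (List.mem_map_of_mem ht)).trans h'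
    refine ⟨ts.attachWith _ hm, ?_, by simp⟩
    have h1 : ts.length ≤ (ts.map size).sum := by
      have := List.length_le_sum_of_one_le (ts.map size) (by
        intro i hi
        obtain ⟨⟨us⟩, -, rfl⟩ := List.mem_map.mp hi
        simp [size])
      simpa using this
    simpa using h1.trans h'

theorem finite_size_eq (n : ℕ) : {T : PlaneTree | T.size = n}.Finite :=
  (finite_size_le n).subset fun _ h => le_of_eq h

/-- The family `𝒯_n` of all planted plane trees of size `n`. -/
noncomputable def family (n : ℕ) : Finset PlaneTree := (finite_size_eq n).toFinset

/-- `a_{𝒯_n}(S)`: the cumulative number of embeddings of `S` into all trees of size `n`. -/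
noncomputable def totalEmb (S : PlaneTree) (n : ℕ) : ℕ := ∑ T ∈ family n, embCount T S

/-- `g_{𝒯_n}(S)`: the cumulative number of good embeddings of `S` into all trees of size `n`. -/
noncomputable def totalGoodEmb (S : PlaneTree) (n : ℕ) : ℕ := ∑ T ∈ family n, goodEmbCount T S

/-- The constant `C = ∏_{i=1}^{m-1} C_{i-1}^{d_i}`, where `m` is the size of `S` and `C_k` is the
`k`-th Catalan number. -/
def catalanConst (S : PlaneTree) : ℕ :=
  ∏ i ∈ Finset.Icc 1 (S.size - 1), catalan (i - 1) ^ S.degreeCount i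

end PlaneTree

namespace PlaneTree

/-! Write `F L` and `T L` for the generating functions (`forestSeries`, `treeSeries`) counting
vertex sets of shape the forest `L` inside all plane forests and all plane trees. Such a set meets
the first tree of a host forest in an initial segment of `L` and the remaining trees in the rest, so
`F L` is a sum of products `T (take k) * F (drop k)` (`forestSeries_eq`). Removing the root of a
host tree gives `T L = X * F L`, with an extra `X * F L'` when `L = [node L']`, for the sets
containing the root.

Let `t = T []` be the Catalan tree series and `s = 1 - 2t`, so that `s ^ 2 = 1 - 4X`. The two
extreme cuts both contribute `t * F L`. Hence, for at least two trees, `s * F L` is the sum over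
cuts into two nonempty parts, and for one tree `s * F [node L'] = t * F L'`. By induction `F L` is,
up to powers of `4X = 1 - s ^ 2`, a polynomial in `s` divided by a power of `s` (`hasLead_forest`).
Each tree of the forest adds its number of vertices plus leaves to the exponent, and cutting forests
in two makes the leading coefficients satisfy Segner's recurrence. This is the source of the Catalan
numbers in the constant.

Euler's limit for Gamma gives the coefficients of each power of `1 - 4X`, and the most negative
power dominates (`HasLead.tendsto_coeff`). For good embeddings of a single vertex no negative power
occurs, and the term `-s / 2` of `t` is used instead. -/

/-! ### Ancestor order and left-to-right order on addresses. -/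

theorem leftOf_cons_cons {a b : ℕ} {p q : List ℕ} :
    LeftOf (a :: p) (b :: q) ↔ a < b ∨ (a = b ∧ LeftOf p q) := by
  constructor
  · rintro ⟨w, i, j, hij, h1, h2⟩
    cases w with
    | nil =>
      simp only [List.nil_append, List.cons_prefix_cons] at h1 h2
      left
      omega
    | cons c w =>
      simp only [List.cons_append, List.cons_prefix_cons] at h1 h2
      exact Or.inr ⟨h1.1.symm.trans h2.1, w, i, j, hij, h1.2, h2.2⟩
  · rintro (h | ⟨rfl, w, i, j, hij, h1, h2⟩)
    · exact ⟨[], a, b, h, by simp, by simp⟩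
    · exact ⟨a :: w, i, j, hij, by simpa using h1, by simpa using h2⟩

theorem not_leftOf_nil_left (q : List ℕ) : ¬ LeftOf [] q := by
  rintro ⟨w, i, j, -, h, -⟩
  simp at h

theorem not_leftOf_nil_right (q : List ℕ) : ¬ LeftOf q [] := by
  rintro ⟨w, i, j, -, -, h⟩
  simp at h

theorem LeftOf.mono {u v u' v' : List ℕ} (h : LeftOf u v) (hu : u <+: u') (hv : v <+: v') :
    LeftOf u' v' := by
  obtain ⟨p, i, j, hij, h1, h2⟩ := h
  exact ⟨p, i, j, hij, h1.trans hu, h2.trans hv⟩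

theorem not_leftOf_self (u : List ℕ) : ¬ LeftOf u u := by
  induction u with
  | nil => exact not_leftOf_nil_left _
  | cons a u ih => simpa [leftOf_cons_cons] using ih

theorem LeftOf.not_prefix {u v : List ℕ} (h : LeftOf u v) : ¬ u <+: v := fun h' =>
  not_leftOf_self v (h.mono h' (List.prefix_refl v))

theorem LeftOf.not_prefix' {u v : List ℕ} (h : LeftOf u v) : ¬ v <+: u := fun h' =>
  not_leftOf_self u (h.mono (List.prefix_refl u) h')

/-- The two relations together compare any two addresses. This totality is what makes a map
preserving both of them injective and order-reflecting. -/
theorem prefix_or_leftOf (u v : List ℕ) : u <+: v ∨ v <+: u ∨ LeftOf u v ∨ LeftOf v u := by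
  induction u generalizing v with
  | nil => simp
  | cons a u ih =>
    cases v with
    | nil => simp
    | cons b v =>
      simp only [List.cons_prefix_cons, leftOf_cons_cons]
      rcases lt_trichotomy a b with h | rfl | h
      · simp [h]
      · simpa using ih v
      · simp [h]

/-! ### Embeddings as vertex sets of a given shape. -/

/-- `HasShape L A`: with the order and the left-to-right order of addresses, the set `A` is a plane
forest whose list of trees is `L`. -/
inductive HasShape : List PlaneTree → Set (List ℕ) → Prop where
  | nil : HasShape [] ∅
  | cons {L₀ L : List PlaneTree} {A₀ A : Set (List ℕ)} {r : List ℕ} :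
      HasShape L₀ A₀ → HasShape L A → (∀ a ∈ A₀, r <+: a ∧ r ≠ a) → (∀ a ∈ A, LeftOf r a) →
      HasShape (node L₀ :: L) (insert r (A₀ ∪ A))

/-- Maps that preserve the strict order and the left-to-right order on `A`. -/
def PreservesOn (f : List ℕ → List ℕ) (A : Set (List ℕ)) : Prop :=
  (∀ u ∈ A, ∀ v ∈ A, u <+: v → u ≠ v → f u <+: f v ∧ f u ≠ f v) ∧
    ∀ u ∈ A, ∀ v ∈ A, LeftOf u v → LeftOf (f u) (f v)

theorem PreservesOn.mono {f : List ℕ → List ℕ} {A B : Set (List ℕ)} (h : PreservesOn f A)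
    (hB : B ⊆ A) : PreservesOn f B :=
  ⟨fun u hu v hv => h.1 u (hB hu) v (hB hv), fun u hu v hv => h.2 u (hB hu) v (hB hv)⟩

theorem PreservesOn.injOn {f : List ℕ → List ℕ} {A : Set (List ℕ)} (h : PreservesOn f A) :
    Set.InjOn f A := by
  intro u hu v hv huv
  by_contra hne
  rcases prefix_or_leftOf u v with h' | h' | h' | h'
  · exact (h.1 u hu v hv h' hne).2 huv
  · exact (h.1 v hv u hu h' (Ne.symm hne)).2 huv.symm
  · exact not_leftOf_self (f v) (huv ▸ h.2 u hu v hv h')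
  · exact not_leftOf_self (f v) (huv ▸ h.2 v hv u hu h')

theorem PreservesOn.prefix_iff {f : List ℕ → List ℕ} {A : Set (List ℕ)} (h : PreservesOn f A)
    {u v : List ℕ} (hu : u ∈ A) (hv : v ∈ A) : u <+: v ↔ f u <+: f v := by
  rcases eq_or_ne u v with rfl | hne
  · simp
  · refine ⟨fun h' => (h.1 u hu v hv h' hne).1, fun hf => ?_⟩
    rcases prefix_or_leftOf u v with h' | h' | h' | h'
    · exact h'
    · have h2 := h.1 v hv u hu h' hne.symm
      exact absurd (h2.1.eq_of_length_le hf.length_le) h2.2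
    · exact absurd hf (h.2 u hu v hv h').not_prefix
    · exact absurd hf (h.2 v hv u hu h').not_prefix'

theorem HasShape.image {L : List PlaneTree} {A : Set (List ℕ)} (h : HasShape L A)
    {f : List ℕ → List ℕ} (hf : PreservesOn f A) : HasShape L (f '' A) := by
  induction h with
  | nil => simpa using HasShape.nil
  | @cons L₀ L A₀ A r h₀ h h1 h2 ih₀ ih =>
    rw [Set.image_insert_eq, Set.image_union]
    refine .cons (ih₀ (hf.mono ?_)) (ih (hf.mono ?_)) ?_ ?_
    · exact fun x hx => by simp [hx]
    · exact fun x hx => by simp [hx]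
    · rintro _ ⟨a, ha, rfl⟩
      exact hf.1 r (by simp) a (by simp [ha]) (h1 a ha).1 (h1 a ha).2
    · rintro _ ⟨a, ha, rfl⟩
      exact hf.2 r (by simp) a (by simp [ha]) (h2 a ha)

/-- The address obtained by moving one tree to the right in a forest. -/
def shift : List ℕ → List ℕ
  | [] => []
  | i :: p => (i + 1) :: p

/-- The address obtained by moving one tree to the left in a forest. -/
def unshift : List ℕ → List ℕ
  | [] => []
  | i :: p => (i - 1) :: p

/-- The vertices of a forest, that is, the vertices of `node L` other than the root. -/
def forestVertices (L : List PlaneTree) : Set (List ℕ) := (node L).vertices \ {[]}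

theorem nil_mem_vertices (T : PlaneTree) : [] ∈ T.vertices := .root T

theorem nil_notMem_forestVertices (L : List PlaneTree) : [] ∉ forestVertices L := by
  simp [forestVertices]

theorem vertices_node (L : List PlaneTree) : (node L).vertices = insert [] (forestVertices L) := by
  rw [forestVertices, Set.insert_sdiff_singleton, Set.insert_eq_of_mem (nil_mem_vertices _)]

theorem cons_mem_forestVertices {L : List PlaneTree} {i : ℕ} {p : List ℕ} :
    i :: p ∈ forestVertices L ↔ ∃ t, L[i]? = some t ∧ p ∈ t.vertices := by
  constructor
  · rintro ⟨h, -⟩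
    cases h with
    | child h1 h2 => exact ⟨_, h1, h2⟩
  · rintro ⟨t, h1, h2⟩
    exact ⟨.child h1 h2, by simp⟩

theorem forestVertices_nil : forestVertices [] = ∅ := by
  ext p
  cases p with
  | nil => simp [nil_notMem_forestVertices]
  | cons i p => simp [cons_mem_forestVertices]

theorem forestVertices_cons (t : PlaneTree) (L : List PlaneTree) :
    forestVertices (t :: L) = List.cons 0 '' t.vertices ∪ shift '' forestVertices L := by
  ext p
  rcases p with _ | ⟨_ | i, p⟩
  · simp only [nil_notMem_forestVertices, Set.mem_union, Set.mem_image, false_iff, not_or]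
    refine ⟨by simp, ?_⟩
    rintro ⟨_ | ⟨i, q⟩, h, h'⟩
    · exact nil_notMem_forestVertices L h
    · simp [shift] at h'
  · rw [cons_mem_forestVertices]
    simp only [List.getElem?_cons_zero, Option.some.injEq, Set.mem_union,
      Set.mem_image, List.cons.injEq, true_and, exists_eq_left', exists_eq_right]
    refine ⟨Or.inl, ?_⟩
    rintro (h | ⟨_ | ⟨i, q⟩, h, h'⟩)
    · exact h
    · simp [shift] at h'
    · simp [shift] at h'
  · rw [cons_mem_forestVertices]
    simp only [List.getElem?_cons_succ, Set.mem_union, Set.mem_image]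
    rw [← cons_mem_forestVertices]
    constructor
    · exact fun h => Or.inr ⟨i :: p, h, rfl⟩
    · rintro (⟨q, -, h⟩ | ⟨_ | ⟨j, q⟩, h, h'⟩)
      · simp at h
      · simp [shift] at h'
      · simp only [shift, List.cons.injEq, Nat.add_right_cancel_iff] at h'
        rwa [← h'.1, ← h'.2]

theorem preservesOn_cons (a : ℕ) (A : Set (List ℕ)) : PreservesOn (List.cons a) A :=
  ⟨fun u _ v _ h h' => by simpa using ⟨h, h'⟩, fun u _ v _ h => by simpa [leftOf_cons_cons] using h⟩

theorem preservesOn_shift {A : Set (List ℕ)} (hA : [] ∉ A) : PreservesOn shift A := by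
  constructor
  · rintro (_ | ⟨i, u⟩) hu (_ | ⟨j, v⟩) hv h h'
    · exact absurd hu hA
    · exact absurd hu hA
    · exact absurd hv hA
    · simpa [shift] using And.intro h h'
  · rintro (_ | ⟨i, u⟩) hu (_ | ⟨j, v⟩) hv h
    · exact absurd hu hA
    · exact absurd hu hA
    · exact absurd hv hA
    · simpa [shift, leftOf_cons_cons] using h

theorem unshift_shift (u : List ℕ) : unshift (shift u) = u := by
  cases u <;> simp [shift, unshift]

theorem shift_injective : Function.Injective shift :=
  Function.LeftInverse.injective unshift_shift

theorem hasShape_cons_iff {L : List PlaneTree} {A : Set (List ℕ)} (a : ℕ) :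
    HasShape L (List.cons a '' A) ↔ HasShape L A := by
  refine ⟨fun h => ?_, fun h => h.image (preservesOn_cons a A)⟩
  have := h.image (f := List.tail) ⟨?_, ?_⟩
  · simpa [Set.image_image] using this
  · rintro _ ⟨u, -, rfl⟩ _ ⟨v, -, rfl⟩ h h'
    simpa using And.intro h h'
  · rintro _ ⟨u, -, rfl⟩ _ ⟨v, -, rfl⟩ h
    simpa [leftOf_cons_cons] using h

theorem hasShape_shift_iff {L : List PlaneTree} {A : Set (List ℕ)} (hA : [] ∉ A) :
    HasShape L (shift '' A) ↔ HasShape L A := by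
  refine ⟨fun h => ?_, fun h => h.image (preservesOn_shift hA)⟩
  have := h.image (f := unshift) ⟨?_, ?_⟩
  · simpa [Set.image_image, unshift_shift] using this
  · rintro _ ⟨u, hu, rfl⟩ _ ⟨v, hv, rfl⟩ h h'
    have := preservesOn_shift hA
    rw [unshift_shift, unshift_shift]
    exact ⟨(this.prefix_iff hu hv).2 h, fun h2 => h' (h2 ▸ rfl)⟩
  · rintro _ ⟨u, hu, rfl⟩ _ ⟨v, hv, rfl⟩ h
    rcases u with _ | ⟨i, u⟩
    · exact absurd hu hA
    rcases v with _ | ⟨j, v⟩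
    · exact absurd hv hA
    simpa [shift, unshift, leftOf_cons_cons] using h

theorem leftOf_zero_cons_shift {u v : List ℕ} (hv : v ≠ []) : LeftOf (0 :: u) (shift v) := by
  cases v with
  | nil => exact absurd rfl hv
  | cons i v => simp [shift, leftOf_cons_cons]

theorem hasShape_forestVertices : ∀ L : List PlaneTree, HasShape L (forestVertices L)
  | [] => by simpa [forestVertices_nil] using HasShape.nil
  | node L₀ :: L => by
    rw [forestVertices_cons, vertices_node, Set.image_insert_eq, Set.insert_union]
    refine .cons ((hasShape_forestVertices L₀).image (preservesOn_cons 0 _))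
      ((hasShape_forestVertices L).image (preservesOn_shift (nil_notMem_forestVertices L))) ?_ ?_
    · rintro _ ⟨u, hu, rfl⟩
      simp only [List.cons_prefix_cons, List.nil_prefix, and_self, ne_eq, List.cons.injEq, true_and]
      rintro rfl
      exact nil_notMem_forestVertices L₀ hu
    · rintro _ ⟨u, hu, rfl⟩
      exact leftOf_zero_cons_shift fun h => nil_notMem_forestVertices L (h ▸ hu)

theorem hasShape_vertices (T : PlaneTree) : HasShape [T] T.vertices := by
  obtain ⟨L⟩ := T
  have := HasShape.cons (r := []) (hasShape_forestVertices L) .nil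
    (fun a ha => ⟨List.nil_prefix, fun h => nil_notMem_forestVertices L (h ▸ ha)⟩) (by simp)
  rwa [Set.union_empty, ← vertices_node] at this

theorem IsVertex.of_prefix {T : PlaneTree} {u v : List ℕ} (h : T.IsVertex v) (huv : u <+: v) :
    T.IsVertex u := by
  induction h generalizing u with
  | root T => rw [List.prefix_nil.1 huv]; exact .root T
  | child h1 h2 ih =>
    cases u with
    | nil => exact .root _
    | cons j u =>
      obtain ⟨rfl, h⟩ := List.cons_prefix_cons.1 huv
      exact .child h1 (ih h)

/-- The map that embeds a forest with first tree `node L₀`, assembled from the image `r` of the root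
of the first tree, the map `f₀` for `L₀` and the map `f` for the other trees. -/
def glue (r : List ℕ) (f₀ f : List ℕ → List ℕ) : List ℕ → List ℕ
  | [] => []
  | [0] => r
  | 0 :: i :: p => f₀ (i :: p)
  | (i + 1) :: p => f (i :: p)

/-- Together with `hasShape_forestVertices` and `HasShape.image`, this makes `forestVertices L` the
universal model of shape `L`. -/
theorem HasShape.exists_preservesOn {L : List PlaneTree} {A : Set (List ℕ)} (h : HasShape L A) :
    ∃ f, PreservesOn f (forestVertices L) ∧ f '' forestVertices L = A := by
  induction h with
  | nil => exact ⟨id, by simp [PreservesOn, forestVertices_nil], by simp [forestVertices_nil]⟩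
  | @cons L₀ L A₀ A r h₀ h h1 h2 ih₀ ih =>
    obtain ⟨f₀, hf₀, rfl⟩ := ih₀
    obtain ⟨f, hf, rfl⟩ := ih
    have hz : ∀ p, 0 :: p ∈ forestVertices (node L₀ :: L) → p = [] ∨ p ∈ forestVertices L₀ := by
      intro p hp
      simpa [cons_mem_forestVertices, vertices_node] using hp
    have hs : ∀ i p, (i + 1) :: p ∈ forestVertices (node L₀ :: L) → i :: p ∈ forestVertices L := by
      intro i p hp
      simpa [cons_mem_forestVertices] using hp
    have hn := nil_notMem_forestVertices (node L₀ :: L)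
    refine ⟨glue r f₀ f, ⟨?_, ?_⟩, ?_⟩
    · rintro (_ | ⟨_ | i, _ | ⟨a, p⟩⟩) hu (_ | ⟨_ | j, _ | ⟨b, q⟩⟩) hv h h' <;>
        first
        | exact absurd hu hn
        | exact absurd hv hn
        | exact absurd rfl h'
        | (exfalso; simp at h; done)
        | skip
      · exact h1 _ ⟨_, (hz _ hv).resolve_left (by simp), rfl⟩
      · exact hf₀.1 _ ((hz _ hu).resolve_left (by simp)) _ ((hz _ hv).resolve_left (by simp))
          (by simpa using h) (by simpa using h')
      all_goals exact hf.1 _ (hs _ _ hu) _ (hs _ _ hv) (by simpa using h) (by simp_all)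
    · rintro (_ | ⟨_ | i, _ | ⟨a, p⟩⟩) hu (_ | ⟨_ | j, _ | ⟨b, q⟩⟩) hv h <;>
        first
        | exact absurd hu hn
        | exact absurd hv hn
        | (exfalso; simp [leftOf_cons_cons, not_leftOf_nil_left, not_leftOf_nil_right] at h; done)
        | exact h2 _ ⟨_, hs _ _ hv, rfl⟩
        | exact (h2 _ ⟨_, hs _ _ hv, rfl⟩).mono
            (h1 _ ⟨_, (hz _ hu).resolve_left (by simp), rfl⟩).1 (List.prefix_refl _)
        | exact hf.2 _ (hs _ _ hu) _ (hs _ _ hv) (by simpa [leftOf_cons_cons] using h)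
        | skip
      exact hf₀.2 _ ((hz _ hu).resolve_left (by simp)) _ ((hz _ hv).resolve_left (by simp))
        (by simpa [leftOf_cons_cons] using h)
    · rw [forestVertices_cons, vertices_node, Set.image_insert_eq, Set.insert_union,
        Set.image_insert_eq, Set.image_union, Set.image_image, Set.image_image]
      congr 2
      · refine Set.image_congr fun p hp => ?_
        cases p with
        | nil => exact absurd hp (nil_notMem_forestVertices _)
        | cons i p => rfl
      · refine Set.image_congr fun p hp => ?_
        cases p with
        | nil => exact absurd hp (nil_notMem_forestVertices _)
        | cons i p => rfl

/-- The inductive `HasShape` refers to no map, so embeddings can be counted by decomposing sets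
recursively. -/
theorem isEmbedding_iff {S T : PlaneTree} {A : Set (List ℕ)} :
    IsEmbedding S T A ↔ A ⊆ T.vertices ∧ HasShape [S] A := by
  refine and_congr_right fun _ => ⟨?_, fun h => ?_⟩
  · rintro ⟨φ, hφ, h1, h2⟩
    have : PreservesOn φ S.vertices := by
      refine ⟨fun u hu v hv h h' => ⟨(h1 u hu v hv).1 h, fun h2 => h' (hφ.injOn hu hv h2)⟩, ?_⟩
      -- Only siblings are assumed to keep their order. The siblings `p ++ [i]` and `p ++ [j]`
      -- separating `u` from `v` are vertices of `S`, and the order of their images passes to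
      -- descendants.
      rintro u hu v hv ⟨p, i, j, hij, hi, hj⟩
      have hi' := IsVertex.of_prefix hu hi
      have hj' := IsVertex.of_prefix hv hj
      exact (h2 p i j hi' hj' hij).mono ((h1 _ hi' u hu).1 hi) ((h1 _ hj' v hv).1 hj)
    rw [← hφ.image_eq]
    exact (hasShape_vertices S).image this
  · obtain ⟨f, hf, rfl⟩ := h.exists_preservesOn
    have hS : forestVertices [S] = List.cons 0 '' S.vertices := by
      simp [forestVertices_cons, forestVertices_nil]
    have hm : ∀ u ∈ S.vertices, 0 :: u ∈ forestVertices [S] := fun u hu => hS ▸ ⟨u, hu, rfl⟩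
    refine ⟨f ∘ List.cons 0, ?_, fun u hu v hv => ?_, fun u i j hi hj hij => ?_⟩
    · rw [hS, ← Set.image_comp]
      refine Set.InjOn.bijOn_image fun u hu v hv h => ?_
      simpa using hf.injOn (hm u hu) (hm v hv) h
    · rw [Function.comp_apply, Function.comp_apply, ← hf.prefix_iff (hm u hu) (hm v hv)]
      simp
    · exact hf.2 _ (hm _ hi) _ (hm _ hj) ⟨0 :: u, i, j, hij, by simp, by simp⟩

/-! ### Sizes, and decompositions at the root and after the first host tree. -/

theorem size_pos (T : PlaneTree) : 0 < T.size := by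
  obtain ⟨L⟩ := T
  simp [size]

/-- The number of vertices of a forest. -/
def forestSize (L : List PlaneTree) : ℕ := (L.map size).sum

theorem size_node (L : List PlaneTree) : (node L).size = 1 + forestSize L := by
  rw [size, forestSize]

@[simp] theorem forestSize_nil : forestSize [] = 0 := rfl

@[simp] theorem forestSize_cons (t : PlaneTree) (L : List PlaneTree) :
    forestSize (t :: L) = t.size + forestSize L := by simp [forestSize]

theorem forestSize_append (L L' : List PlaneTree) :
    forestSize (L ++ L') = forestSize L + forestSize L' := by simp [forestSize]

theorem eq_nil_of_forestSize {L : List PlaneTree} (h : forestSize L = 0) : L = [] := by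
  cases L with
  | nil => rfl
  | cons t L =>
    have := size_pos t
    simp at h
    omega

/-- Trees are nonempty, so a cut position is determined by the number of vertices before it. This
makes the cases of `forestCount_cons` disjoint. -/
theorem take_eq_of_forestSize {L : List PlaneTree} {j k : ℕ} (hj : j ≤ L.length)
    (hk : k ≤ L.length) (h : forestSize (L.take j) = forestSize (L.take k)) : j = k := by
  wlog hjk : j ≤ k generalizing j k
  · exact (this hk hj h.symm (by omega)).symm
  have h1 : L.take k = L.take j ++ (L.take k).drop j := by
    conv_lhs => rw [← List.take_append_drop j (L.take k)]
    rw [List.take_take, min_eq_left hjk]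
  rw [h1, forestSize_append] at h
  have h2 := congrArg List.length (eq_nil_of_forestSize (L := (L.take k).drop j) (by omega))
  simp at h2
  omega

theorem HasShape.ncard {L : List PlaneTree} {A : Set (List ℕ)} (h : HasShape L A) :
    A.Finite ∧ A.ncard = forestSize L := by
  induction h with
  | nil => simp
  | @cons L₀ L A₀ A r h₀ h h1 h2 ih₀ ih =>
    refine ⟨(ih₀.1.union ih.1).insert _, ?_⟩
    have hr : r ∉ A₀ ∪ A := by
      rintro (hr | hr)
      · exact (h1 r hr).2 rfl
      · exact not_leftOf_self r (h2 r hr)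
    have hd : Disjoint A₀ A := Set.disjoint_left.2 fun a ha ha' =>
      (h2 a ha').not_prefix (h1 a ha).1
    rw [Set.ncard_insert_of_notMem hr (ih₀.1.union ih.1), Set.ncard_union_eq hd ih₀.1 ih.1, ih₀.2,
      ih.2, forestSize_cons, size_node]
    omega

theorem hasShape_nil_iff {A : Set (List ℕ)} : HasShape [] A ↔ A = ∅ := by
  constructor
  · intro h
    cases h
    rfl
  · rintro rfl
    exact .nil

theorem HasShape.eq_nil {L : List PlaneTree} (h : HasShape L ∅) : L = [] :=
  eq_nil_of_forestSize (by simpa using h.ncard.2.symm)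

theorem eq_of_insert_eq {α : Type*} {a : α} {A B : Set α} (hA : a ∉ A) (hB : a ∉ B)
    (h : insert a A = insert a B) : A = B := by
  rw [← Set.insert_sdiff_self_of_notMem hA, h, Set.insert_sdiff_self_of_notMem hB]

/-- The address `[]` is below no other address and has nothing to its left or right, so it must be
the root of the only tree of the shape. -/
theorem hasShape_insert_nil {L : List PlaneTree} {A : Set (List ℕ)} (hA : [] ∉ A) :
    HasShape L (insert [] A) ↔ ∃ L', L = [node L'] ∧ HasShape L' A := by
  constructor
  · generalize hB : insert [] A = B
    have hm : [] ∈ B := hB ▸ Set.mem_insert _ _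
    intro h
    cases h with
    | nil => simp at hm
    | @cons L₀ L A₀ A' r h₀ h h1 h2 =>
      have h3 : [] = r := by
        rcases hm with hm | hm | hm
        · exact hm
        · exact absurd (List.prefix_nil.1 (h1 _ hm).1) (h1 _ hm).2
        · exact absurd (h2 _ hm) (not_leftOf_nil_right r)
      subst h3
      obtain rfl : A' = ∅ :=
        Set.eq_empty_of_forall_notMem fun a ha => not_leftOf_nil_left a (h2 a ha)
      obtain rfl := h.eq_nil
      rw [Set.union_empty] at hB
      have h4 : [] ∉ A₀ := fun h => (h1 _ h).2 rfl
      refine ⟨L₀, rfl, ?_⟩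
      rwa [eq_of_insert_eq hA h4 hB]
  · rintro ⟨L', rfl, h⟩
    have := HasShape.cons (r := []) h .nil
      (fun a ha => ⟨List.nil_prefix, fun h => hA (h ▸ ha)⟩) (by simp)
    rwa [Set.union_empty] at this

theorem HasShape.append {L₁ L₂ : List PlaneTree} {A₁ A₂ : Set (List ℕ)} (h₁ : HasShape L₁ A₁)
    (h₂ : HasShape L₂ A₂) (h : ∀ a ∈ A₁, ∀ b ∈ A₂, LeftOf a b) :
    HasShape (L₁ ++ L₂) (A₁ ∪ A₂) := by
  induction h₁ with
  | nil => simpa using h₂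
  | @cons L₀ L A₀ A r h₀ h' h1 h2 ih₀ ih =>
    rw [Set.insert_union, Set.union_assoc]
    refine .cons h₀ (ih fun a ha => h a (by simp [ha])) h1 ?_
    rintro a (ha | ha)
    · exact h2 a ha
    · exact h r (by simp) a ha

/-- Each tree of the shape lies inside the host tree of its root. Once a root lies outside the first
host tree, so does everything after it. -/
theorem HasShape.split {L : List PlaneTree} {A : Set (List ℕ)} (h : HasShape L A)
    (hA : [] ∉ A) : ∃ L₁ L₂ A₁ A₂, L = L₁ ++ L₂ ∧ A = List.cons 0 '' A₁ ∪ shift '' A₂ ∧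
      [] ∉ A₂ ∧ HasShape L₁ A₁ ∧ HasShape L₂ A₂ := by
  have hright : ∀ {L A}, HasShape L A → (∀ a ∈ A, ∃ i p, a = (i + 1) :: p) →
      ∃ A₂, A = shift '' A₂ ∧ [] ∉ A₂ ∧ HasShape L A₂ := by
    intro L A h hA
    have h1 : [] ∉ unshift '' A := by
      rintro ⟨a, ha, h⟩
      obtain ⟨i, p, rfl⟩ := hA a ha
      simp [unshift] at h
    have h2 : A = shift '' (unshift '' A) := by
      rw [Set.image_image]
      conv_lhs => rw [← Set.image_id A]
      refine Set.image_congr fun a ha => ?_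
      obtain ⟨i, p, rfl⟩ := hA a ha
      simp [shift, unshift]
    refine ⟨_, h2, h1, ?_⟩
    rwa [← hasShape_shift_iff h1, ← h2]
  induction h with
  | nil => exact ⟨[], [], ∅, ∅, by simp, by simp, by simp, .nil, .nil⟩
  | @cons L₀ L A₀ A r h₀ h h1 h2 ih₀ ih =>
    rcases r with _ | ⟨_ | i, p⟩
    · simp at hA
    · obtain ⟨L₁, L₂, A₁, A₂, rfl, rfl, hn, hA₁, hA₂⟩ := ih fun h => hA (by simp [h])
      obtain ⟨B, rfl⟩ : ∃ B, A₀ = List.cons 0 '' B := by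
        refine ⟨List.tail '' A₀, ?_⟩
        rw [Set.image_image]
        conv_lhs => rw [← Set.image_id A₀]
        refine Set.image_congr fun a ha => ?_
        obtain ⟨q, rfl⟩ := (h1 a ha).1
        simp
      refine ⟨node L₀ :: L₁, L₂, insert p (B ∪ A₁), A₂, rfl, ?_, hn, ?_, hA₂⟩
      · rw [Set.image_insert_eq, Set.image_union, Set.insert_union, Set.union_assoc]
      · refine .cons ((hasShape_cons_iff 0).1 h₀) hA₁ ?_ ?_
        · intro a ha
          simpa using h1 (0 :: a) ⟨a, ha, rfl⟩
        · intro a ha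
          simpa [leftOf_cons_cons] using h2 (0 :: a) (Or.inl ⟨a, ha, rfl⟩)
    · obtain ⟨B, hB, hn, hs⟩ := hright (.cons h₀ h h1 h2) (by
        rintro a (rfl | ha | ha)
        · exact ⟨i, p, rfl⟩
        · obtain ⟨q, rfl⟩ := (h1 a ha).1
          exact ⟨i, p ++ q, rfl⟩
        · rcases a with _ | ⟨_ | j, q⟩
          · exact absurd (h2 _ ha) (not_leftOf_nil_right _)
          · have := h2 _ ha
            simp [leftOf_cons_cons] at this
          · exact ⟨j, q, rfl⟩)
      exact ⟨[], _, ∅, B, rfl, by rw [hB]; simp, hn, .nil, hs⟩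

/-! ### Recursions for the counts. -/

/-- The subsets of `V` that form a forest of shape `L`. -/
def shapes (L : List PlaneTree) (V : Set (List ℕ)) : Set (Set (List ℕ)) :=
  {A | A ⊆ V ∧ HasShape L A}

theorem finite_shapes (L : List PlaneTree) {V : Set (List ℕ)} (hV : V.Finite) :
    (shapes L V).Finite :=
  hV.finite_subsets.subset fun _ h => h.1

/-- The number of embeddings of the forest `L` into the tree `T`. -/
noncomputable def treeCount (L : List PlaneTree) (T : PlaneTree) : ℕ :=
  (shapes L T.vertices).ncard

/-- The number of embeddings of the forest `L` into the forest `ts`. -/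
noncomputable def forestCount (L ts : List PlaneTree) : ℕ :=
  (shapes L (forestVertices ts)).ncard

theorem finite_forestVertices (ts : List PlaneTree) : (forestVertices ts).Finite :=
  (finite_vertices _).subset Set.sdiff_subset

theorem embCount_eq (T S : PlaneTree) : embCount T S = treeCount [S] T := by
  simp only [embCount, treeCount, shapes, isEmbedding_iff]

theorem shapes_node (L ts : List PlaneTree) : shapes L (node ts).vertices =
    shapes L (forestVertices ts) ∪ {A | A ⊆ (node ts).vertices ∧ HasShape L A ∧ [] ∈ A} := by
  ext A
  simp only [shapes, vertices_node, Set.mem_ofPred_eq, Set.mem_union]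
  by_cases h : [] ∈ A
  · have : ¬ A ⊆ forestVertices ts := fun h' => nil_notMem_forestVertices ts (h' h)
    simp [h, this]
  · simp [h, Set.subset_insert_iff_of_notMem h]

theorem ncard_rooted_shapes (L ts : List PlaneTree) :
    {A | A ⊆ (node ts).vertices ∧ HasShape [node L] A ∧ [] ∈ A}.ncard = forestCount L ts := by
  have : {A | A ⊆ (node ts).vertices ∧ HasShape [node L] A ∧ [] ∈ A} =
      insert [] '' shapes L (forestVertices ts) := by
    ext A
    simp only [shapes, vertices_node, Set.mem_ofPred_eq, Set.mem_image]
    constructor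
    · rintro ⟨h1, h2, h3⟩
      have h4 : insert [] (A \ {[]}) = A := by
        rw [Set.insert_sdiff_singleton, Set.insert_eq_of_mem h3]
      have h5 : [] ∉ A \ {[]} := by simp
      rw [← h4, hasShape_insert_nil h5] at h2
      obtain ⟨L', h6, h7⟩ := h2
      obtain rfl : L = L' := by simpa using h6
      exact ⟨A \ {[]}, ⟨by simpa using h1, h7⟩, h4⟩
    · rintro ⟨B, ⟨h1, h2⟩, rfl⟩
      refine ⟨Set.insert_subset_insert h1, ?_, Set.mem_insert _ _⟩
      exact (hasShape_insert_nil fun h => nil_notMem_forestVertices ts (h1 h)).2 ⟨L, rfl, h2⟩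
  rw [this, forestCount, Set.InjOn.ncard_image]
  intro A hA B hB h
  exact eq_of_insert_eq (fun h => nil_notMem_forestVertices ts (hA.1 h))
    (fun h => nil_notMem_forestVertices ts (hB.1 h)) h

theorem goodEmbCount_node (L ts : List PlaneTree) :
    goodEmbCount (node ts) (node L) = forestCount L ts := by
  rw [← ncard_rooted_shapes]
  simp only [goodEmbCount, isEmbedding_iff, and_assoc]

theorem treeCount_singleton (L ts : List PlaneTree) :
    treeCount [node L] (node ts) = forestCount [node L] ts + forestCount L ts := by
  rw [treeCount, shapes_node, Set.ncard_union_eq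
    (Set.disjoint_left.2 fun A hA hA' => nil_notMem_forestVertices ts (hA.1 hA'.2.2))
    (finite_shapes _ (finite_forestVertices ts))
    ((finite_vertices (node ts)).finite_subsets.subset fun _ h => h.1),
    ncard_rooted_shapes]
  rfl

theorem treeCount_of_length_ne_one {L : List PlaneTree} (hL : L.length ≠ 1)
    (ts : List PlaneTree) : treeCount L (node ts) = forestCount L ts := by
  have : {A | A ⊆ (node ts).vertices ∧ HasShape L A ∧ [] ∈ A} = ∅ := by
    refine Set.eq_empty_of_forall_notMem ?_
    rintro A ⟨-, h2, h3⟩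
    have h5 : [] ∉ A \ {[]} := by simp
    rw [← Set.insert_eq_of_mem h3, ← Set.insert_sdiff_singleton, hasShape_insert_nil h5] at h2
    obtain ⟨L', rfl, -⟩ := h2
    simp at hL
  rw [treeCount, shapes_node, this, Set.union_empty, forestCount]

theorem forestCount_nil (L : List PlaneTree) :
    forestCount L [] = if L = [] then 1 else 0 := by
  have : shapes L (forestVertices []) = if L = [] then {∅} else ∅ := by
    ext A
    simp only [shapes, forestVertices_nil, Set.subset_empty_iff, Set.mem_ofPred_eq]
    split_ifs with h
    · simp [h, hasShape_nil_iff]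
    · simp only [Set.mem_empty_iff_false, iff_false, not_and]
      rintro rfl h'
      exact h h'.eq_nil
  rw [forestCount, this]
  split_ifs <;> simp

/-- The union of a set in the first tree and a set in the other trees of a forest. -/
def joinSets (P : Set (List ℕ) × Set (List ℕ)) : Set (List ℕ) :=
  List.cons 0 '' P.1 ∪ shift '' P.2

theorem joinSets_inj {A B A' B' : Set (List ℕ)} (hB : [] ∉ B) (hB' : [] ∉ B')
    (h : joinSets (A, B) = joinSets (A', B')) : A = A' ∧ B = B' := by
  have h0 : ∀ {A B : Set (List ℕ)}, ∀ p, 0 :: p ∈ joinSets (A, B) ↔ p ∈ A := by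
    intro A B p
    simp only [joinSets, Set.mem_union, Set.mem_image, List.cons.injEq, true_and, exists_eq_right,
      or_iff_left_iff_imp]
    rintro ⟨_ | ⟨j, q⟩, -, h⟩ <;> simp [shift] at h
  have h1 : ∀ {A B : Set (List ℕ)}, ∀ i p, (i + 1) :: p ∈ joinSets (A, B) ↔ i :: p ∈ B := by
    intro A B i p
    rw [show (i + 1) :: p = shift (i :: p) from rfl]
    simp only [joinSets, Set.mem_union, shift_injective.mem_set_image]
    simp [shift]
  constructor
  · ext p
    rw [← h0, h, h0]
  · ext p
    cases p with
    | nil => simp [hB, hB']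
    | cons i p => rw [← h1, h, h1]

theorem shapes_cons (L : List PlaneTree) (t : PlaneTree) (ts : List PlaneTree) :
    shapes L (forestVertices (t :: ts)) = ⋃ k ∈ (Finset.range (L.length + 1) : Set ℕ),
      joinSets '' (shapes (L.take k) t.vertices ×ˢ shapes (L.drop k) (forestVertices ts)) := by
  ext A
  simp only [Set.mem_iUnion, Finset.coe_range, Set.mem_Iio, exists_prop, Set.mem_image,
    Prod.exists, Set.mem_prod]
  constructor
  · rintro ⟨h1, h2⟩
    obtain ⟨L₁, L₂, A₁, A₂, rfl, rfl, hn, hA₁, hA₂⟩ :=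
      h2.split fun h => nil_notMem_forestVertices _ (h1 h)
    rw [forestVertices_cons] at h1
    refine ⟨L₁.length, by simp, A₁, A₂, ⟨⟨?_, by simpa⟩, ?_, by simpa⟩, rfl⟩
    · intro p hp
      rcases h1 (Or.inl ⟨p, hp, rfl⟩) with ⟨q, hq, h⟩ | ⟨_ | ⟨i, q⟩, hq, h⟩
      · simp at h
        rwa [← h]
      · simp [shift] at h
      · simp [shift] at h
    · intro p hp
      rcases h1 (Or.inr ⟨p, hp, rfl⟩) with ⟨q, hq, h⟩ | ⟨q, hq, h⟩
      · cases p with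
        | nil => exact absurd hp hn
        | cons => simp [shift] at h
      · rwa [← shift_injective h]
  · rintro ⟨k, hk, A₁, A₂, ⟨⟨h1, h2⟩, h3, h4⟩, rfl⟩
    have hn : [] ∉ A₂ := fun h => nil_notMem_forestVertices ts (h3 h)
    refine ⟨?_, ?_⟩
    · rw [forestVertices_cons]
      exact Set.union_subset_union (Set.image_mono h1) (Set.image_mono h3)
    · rw [← List.take_append_drop k L]
      refine ((hasShape_cons_iff 0).2 h2).append ((hasShape_shift_iff hn).2 h4) ?_
      rintro _ ⟨a, ha, rfl⟩ _ ⟨b, hb, rfl⟩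
      exact leftOf_zero_cons_shift fun h => hn (h ▸ hb)

theorem forestCount_cons (L : List PlaneTree) (t : PlaneTree) (ts : List PlaneTree) :
    forestCount L (t :: ts) = ∑ k ∈ Finset.range (L.length + 1),
      treeCount (L.take k) t * forestCount (L.drop k) ts := by
  have hn : ∀ {L B}, B ∈ shapes L (forestVertices ts) → [] ∉ B := fun hB h =>
    nil_notMem_forestVertices ts (hB.1 h)
  rw [forestCount, shapes_cons, Set.Finite.ncard_biUnion (Finset.finite_toSet _),
    finsum_mem_coe_finset]
  · refine Finset.sum_congr rfl fun k _ => ?_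
    rw [Set.InjOn.ncard_image, Set.ncard_prod, treeCount, forestCount]
    rintro ⟨A, B⟩ hAB ⟨A', B'⟩ hAB' h
    obtain ⟨rfl, rfl⟩ := joinSets_inj (hn hAB.2) (hn hAB'.2) h
    rfl
  · exact fun k _ => ((finite_shapes _ (finite_vertices t)).prod
      (finite_shapes _ (finite_forestVertices ts))).image _
  · intro j hj k hk hjk
    refine Set.disjoint_left.2 ?_
    rintro _ ⟨⟨A, B⟩, ⟨hA, hB⟩, rfl⟩ ⟨⟨A', B'⟩, ⟨hA', hB'⟩, h⟩
    obtain ⟨rfl, rfl⟩ := joinSets_inj (hn hB') (hn hB) h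
    -- The part inside the first host tree has the same cardinality under both cuts.
    refine hjk (take_eq_of_forestSize (L := L) ?_ ?_ ?_)
    · simpa [Nat.lt_succ_iff] using hj
    · simpa [Nat.lt_succ_iff] using hk
    · exact hA.2.ncard.2.symm.trans hA'.2.ncard.2

/-! ### Generating functions and their functional equations. -/

open PowerSeries Topology

theorem finite_forestSize_eq (n : ℕ) : {L : List PlaneTree | forestSize L = n}.Finite := by
  refine ((finite_size_eq (n + 1)).preimage (f := node) fun _ _ _ _ h => by simpa using h).subset ?_
  intro L hL
  simp only [Set.mem_ofPred_eq] at hL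
  simp [size_node, hL, add_comm]

/-- The family of all plane forests with `n` vertices. -/
noncomputable def forestFamily (n : ℕ) : Finset (List PlaneTree) := (finite_forestSize_eq n).toFinset

@[simp] theorem mem_forestFamily {n : ℕ} {L : List PlaneTree} :
    L ∈ forestFamily n ↔ forestSize L = n := by simp [forestFamily]

@[simp] theorem mem_family {n : ℕ} {T : PlaneTree} : T ∈ family n ↔ T.size = n := by simp [family]

theorem family_zero : family 0 = ∅ :=
  Finset.eq_empty_of_forall_notMem fun T hT => (size_pos T).ne' (by simpa using hT)

theorem sum_family_succ {M : Type*} [AddCommMonoid M] (f : PlaneTree → M) (n : ℕ) :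
    ∑ T ∈ family (n + 1), f T = ∑ ts ∈ forestFamily n, f (node ts) := by
  symm
  refine Finset.sum_bij (fun ts _ => node ts) ?_ (fun _ _ _ _ h => by simpa using h) ?_
    fun _ _ => rfl
  · intro ts h
    simp only [mem_forestFamily] at h
    simp [size_node, h, add_comm]
  · rintro ⟨ts⟩ h
    simp only [mem_family, size_node] at h
    exact ⟨ts, by simp; omega, rfl⟩

theorem sum_forestFamily {M : Type*} [AddCommMonoid M] (f : List PlaneTree → M) (n : ℕ) :
    ∑ ts ∈ forestFamily n, f ts = (if n = 0 then f [] else 0) +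
      ∑ p ∈ Finset.HasAntidiagonal.antidiagonal n, ∑ t ∈ family p.1, ∑ ts ∈ forestFamily p.2, f (t :: ts) := by
  classical
  rw [← Finset.sum_filter_add_sum_filter_not (forestFamily n) (· = [])]
  congr 1
  · rw [Finset.sum_filter, Finset.sum_ite_eq']
    simp [eq_comm]
  · simp_rw [← Finset.sum_product']
    rw [← Finset.sum_sigma (Finset.HasAntidiagonal.antidiagonal n) (fun p => family p.1 ×ˢ forestFamily p.2)
      (fun x => f (x.2.1 :: x.2.2))]
    symm
    refine Finset.sum_bij (fun x _ => x.2.1 :: x.2.2) ?_ ?_ ?_ fun _ _ => rfl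
    · rintro ⟨⟨a, b⟩, t, ts⟩ h
      simp at h ⊢
      omega
    · rintro ⟨⟨a, b⟩, t, ts⟩ h ⟨⟨a', b'⟩, t', ts'⟩ h' heq
      simp at h h' heq
      obtain ⟨rfl, rfl⟩ := heq
      obtain ⟨-, rfl, rfl⟩ := h
      obtain ⟨-, rfl, rfl⟩ := h'
      rfl
    · rintro (_ | ⟨t, ts⟩) h
      · simp at h
      · exact ⟨⟨(t.size, forestSize ts), t, ts⟩, by simpa using h, rfl⟩

/-- The generating function of the embeddings of the forest `L` into trees. -/
noncomputable def treeSeries (L : List PlaneTree) : ℝ⟦X⟧ :=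
  mk fun n => ∑ T ∈ family n, (treeCount L T : ℝ)

/-- The generating function of the embeddings of the forest `L` into forests. -/
noncomputable def forestSeries (L : List PlaneTree) : ℝ⟦X⟧ :=
  mk fun n => ∑ ts ∈ forestFamily n, (forestCount L ts : ℝ)

theorem forestSeries_eq (L : List PlaneTree) : forestSeries L = (if L = [] then 1 else 0) +
    ∑ k ∈ Finset.range (L.length + 1), treeSeries (L.take k) * forestSeries (L.drop k) := by
  ext n
  rw [forestSeries, coeff_mk, sum_forestFamily, map_add, map_sum]
  congr 1
  · rw [forestCount_nil]
    split_ifs <;> simp_all [coeff_one]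
  · simp only [coeff_mul, treeSeries, forestSeries, coeff_mk]
    rw [Finset.sum_comm]
    refine Finset.sum_congr rfl fun p _ => ?_
    simp only [forestCount_cons, Nat.cast_sum, Nat.cast_mul, Finset.sum_mul_sum]
    rw [Finset.sum_comm]
    conv_rhs => rw [Finset.sum_comm]
    rw [Finset.sum_comm]
    refine Finset.sum_congr rfl fun t _ => ?_
    rw [Finset.sum_comm]

theorem treeSeries_of_length_ne_one {L : List PlaneTree} (hL : L.length ≠ 1) :
    treeSeries L = X * forestSeries L := by
  ext n
  cases n with
  | zero => simp [treeSeries, family_zero]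
  | succ n =>
    rw [coeff_succ_X_mul, treeSeries, forestSeries, coeff_mk, coeff_mk, sum_family_succ]
    simp only [treeCount_of_length_ne_one hL]

theorem treeSeries_singleton (L : List PlaneTree) :
    treeSeries [node L] = X * (forestSeries [node L] + forestSeries L) := by
  ext n
  cases n with
  | zero => simp [treeSeries, family_zero]
  | succ n =>
    rw [coeff_succ_X_mul, treeSeries, forestSeries, forestSeries, map_add, coeff_mk, coeff_mk,
      coeff_mk, sum_family_succ]
    simp only [treeCount_singleton, Nat.cast_add, Finset.sum_add_distrib]

theorem coeff_treeSeries_singleton (S : PlaneTree) (n : ℕ) :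
    coeff n (treeSeries [S]) = (S.totalEmb n : ℝ) := by
  simp [treeSeries, totalEmb, embCount_eq]

theorem coeff_X_mul_forestSeries (L : List PlaneTree) (n : ℕ) :
    coeff n (X * forestSeries L) = ((node L).totalGoodEmb n : ℝ) := by
  cases n with
  | zero => simp [totalGoodEmb, family_zero]
  | succ n =>
    rw [coeff_succ_X_mul, forestSeries, coeff_mk, totalGoodEmb, sum_family_succ]
    simp only [goodEmbCount_node, Nat.cast_sum]

/-- The generating function of plane trees. -/
noncomputable def catalanTreeSeries : ℝ⟦X⟧ := treeSeries []

theorem catalanTreeSeries_eq : catalanTreeSeries = X * forestSeries [] :=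
  treeSeries_of_length_ne_one (by simp)

theorem forestSeries_nil_mul : forestSeries [] * (1 - catalanTreeSeries) = 1 := by
  have := forestSeries_eq []
  simp only [if_true, List.length_nil, zero_add, Finset.range_one, Finset.sum_singleton,
    List.take_nil, List.drop_nil] at this
  rw [← catalanTreeSeries] at this
  linear_combination this

theorem catalanTreeSeries_quadratic : catalanTreeSeries * (1 - catalanTreeSeries) = X := by
  rw [catalanTreeSeries_eq, mul_assoc, ← catalanTreeSeries_eq, forestSeries_nil_mul, mul_one]

/-- The generating function of plane trees is `(1 - s) / 2`, where `s` is this square root of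
`1 - 4 X`. -/
noncomputable def sqrtSeries : ℝ⟦X⟧ := 1 - 2 * catalanTreeSeries

theorem sqrtSeries_sq : sqrtSeries ^ 2 = 1 - 4 * X := by
  rw [sqrtSeries]
  linear_combination -4 * catalanTreeSeries_quadratic

theorem constantCoeff_sqrtSeries : constantCoeff sqrtSeries = 1 := by
  simp [sqrtSeries, catalanTreeSeries_eq]

/-- As `X * forestSeries []` is the Catalan tree series `t`, the two cuts give `t * forestSeries
[node L]` twice, plus `t * forestSeries L`. Moving the repeated term to the left produces `1 - 2t`.
-/
theorem sqrtSeries_mul_forestSeries_singleton (L : List PlaneTree) :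
    sqrtSeries * forestSeries [node L] = catalanTreeSeries * forestSeries L := by
  have := forestSeries_eq [node L]
  simp only [reduceCtorEq, if_false, List.length_singleton, zero_add, Finset.sum_range_succ,
    Finset.range_zero, Finset.sum_empty, List.take_zero, List.drop_zero, List.take_succ_cons,
    List.drop_succ_cons, treeSeries_singleton] at this
  rw [← catalanTreeSeries] at this
  rw [sqrtSeries]
  linear_combination this - (forestSeries [node L] + forestSeries L) * catalanTreeSeries_eq

/-- The cuts before the first tree and after the last one each contribute `t * forestSeries L`; the
latter uses `treeSeries L = X * forestSeries L`. The sum keeps the cuts with two nonempty parts. -/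
theorem sqrtSeries_mul_forestSeries {L : List PlaneTree} {n : ℕ} (hL : L.length = n + 2) :
    sqrtSeries * forestSeries L = ∑ k ∈ Finset.range (n + 1),
      treeSeries (L.take (k + 1)) * forestSeries (L.drop (k + 1)) := by
  have := forestSeries_eq L
  have hne : L ≠ [] := by rintro rfl; simp at hL
  rw [if_neg hne, zero_add, hL, Finset.sum_range_succ, Finset.sum_range_succ', ← hL,
    List.take_length, List.drop_length, List.take_zero, List.drop_zero, ← catalanTreeSeries,
    treeSeries_of_length_ne_one (by omega : L.length ≠ 1)] at this
  rw [sqrtSeries]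
  linear_combination this - forestSeries L * catalanTreeSeries_eq

/-! ### Powers of `1 - 4X` and the growth of their coefficients. -/

/-- The power series of `(1 - 4 X) ^ a`. -/
noncomputable def powSeries (a : ℝ) : ℝ⟦X⟧ := rescale (-4) (binomialSeries ℝ a)

theorem powSeries_add (a b : ℝ) : powSeries (a + b) = powSeries a * powSeries b := by
  rw [powSeries, binomialSeries_add, map_mul, powSeries, powSeries]

theorem powSeries_zero : powSeries 0 = 1 := by rw [powSeries, binomialSeries_zero, map_one]

theorem powSeries_one : powSeries 1 = 1 - 4 * X := by
  have := binomialSeries_nat (R := ℝ) (A := ℝ) 1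
  rw [Nat.cast_one, pow_one] at this
  rw [powSeries, this, map_add, map_one, rescale_X, map_neg, neg_mul, ← sub_eq_add_neg]
  rfl

theorem powSeries_nat_mul (a : ℝ) (n : ℕ) : powSeries (n * a) = powSeries a ^ n := by
  induction n with
  | zero => simp [powSeries_zero]
  | succ n ih => rw [pow_succ, ← ih, ← powSeries_add]; push_cast; ring_nf

theorem sqrtSeries_eq_powSeries : sqrtSeries = powSeries (1 / 2) := by
  have h1 : powSeries (1 / 2) ^ 2 = 1 - 4 * X := by
    rw [← powSeries_nat_mul, ← powSeries_one]; norm_num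
  have h2 : (sqrtSeries - powSeries (1 / 2)) * (sqrtSeries + powSeries (1 / 2)) = 0 := by
    linear_combination sqrtSeries_sq - h1
  rcases mul_eq_zero.1 h2 with h | h
  · exact sub_eq_zero.1 h
  -- Both square roots have constant coefficient 1, so they cannot be opposite.
  · have := congrArg constantCoeff h
    rw [map_add, constantCoeff_sqrtSeries, powSeries, ← coeff_zero_eq_constantCoeff_apply,
      coeff_rescale] at this
    norm_num at this

theorem coeff_powSeries (a : ℝ) (n : ℕ) :
    coeff n (powSeries (-a)) = 4 ^ n * (∏ i ∈ Finset.range n, (a + i)) / n.factorial := by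
  have h : (descPochhammer ℤ n).smeval (-a) = (-1) ^ n * ∏ i ∈ Finset.range n, (a + i) := by
    induction n with
    | zero => simp
    | succ n ih =>
      rw [descPochhammer_succ_right, Polynomial.smeval_mul, ih, Finset.prod_range_succ,
        Polynomial.smeval_sub, Polynomial.smeval_X, Polynomial.smeval_natCast]
      simp
      ring
  rw [powSeries, coeff_rescale, binomialSeries_coeff, Ring.choose_eq_smul, h, smul_eq_mul,
    smul_eq_mul, mul_one, show (-4 : ℝ) = -1 * 4 by norm_num, mul_pow]
  have h1 : ((-1 : ℝ) ^ n) * (-1) ^ n = 1 := by rw [← mul_pow]; norm_num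
  linear_combination (4 ^ n * (∏ i ∈ Finset.range n, (a + i)) * (n.factorial : ℝ)⁻¹) * h1

/-- The quotient is the inverse of Euler's sequence `GammaSeq`, corrected by `n / (n + a)` for its
extra factor. At a pole of Gamma the coefficients vanish eventually, in agreement with the
conventions `Gamma = 0` and `0⁻¹ = 0`. -/
theorem tendsto_coeff_powSeries (a : ℝ) :
    Tendsto (fun n : ℕ => coeff n (powSeries (-a)) / (4 ^ n * (n : ℝ) ^ (a - 1))) atTop
      (𝓝 (Real.Gamma a)⁻¹) := by
  by_cases ha : Real.Gamma a = 0
  · obtain ⟨m, rfl⟩ := (Real.Gamma_eq_zero_iff a).1 ha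
    rw [ha, inv_zero]
    refine tendsto_const_nhds.congr' ?_
    filter_upwards [eventually_gt_atTop m] with n hn
    rw [coeff_powSeries, Finset.prod_eq_zero (Finset.mem_range.2 hn) (by simp)]
    simp
  · have h1 := (Real.GammaSeq_tendsto_Gamma a).inv₀ ha
    have h2 : Tendsto (fun n : ℕ => (n : ℝ) / (n + a)) atTop (𝓝 1) := 
      tendsto_natCast_div_add_atTop a
    have h3 := h1.mul h2
    rw [mul_one] at h3
    refine h3.congr' ?_
    have h4 : ∀ᶠ n : ℕ in atTop, (n : ℝ) > -a := 
      tendsto_natCast_atTop_atTop.eventually_gt_atTop (-a)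
    filter_upwards [eventually_gt_atTop 0, h4] with n hn h4
    have hn' : (0 : ℝ) < n := Nat.cast_pos.2 hn
    have h5 : (n : ℝ) + a ≠ 0 := by linarith
    have h6 : (n : ℝ) ^ a ≠ 0 := (Real.rpow_pos_of_pos hn' a).ne'
    rw [Real.GammaSeq, inv_div, Finset.prod_range_succ, coeff_powSeries, Real.rpow_sub_one hn'.ne']
    field_simp
    ring

theorem isEquivalent_of_tendsto_div {u : ℕ → ℝ} {b L : ℝ} (hL : L ≠ 0)
    (h : Tendsto (fun n : ℕ => u n / (4 ^ n * (n : ℝ) ^ b)) atTop (𝓝 L)) :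
    u ~[atTop] fun n : ℕ => L * 4 ^ n * (n : ℝ) ^ b := by
  have hv : ∀ᶠ n : ℕ in atTop, L * 4 ^ n * (n : ℝ) ^ b ≠ 0 := by
    filter_upwards [eventually_gt_atTop 0] with n hn
    have hn' : (0 : ℝ) < n := Nat.cast_pos.2 hn
    have := (Real.rpow_pos_of_pos hn' b).ne'
    positivity
  rw [isEquivalent_iff_tendsto_one hv]
  have := h.div_const L
  rw [div_self hL] at this
  refine this.congr fun n => ?_
  rw [Pi.div_apply, div_div]
  ring_nf

/-! ### Leading terms in `s = sqrt (1 - 4X)`. -/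

/-- `HasLead f κ c`: up to a power of `4 X`, the series `f` is `s ^ (-κ)` times a polynomial in
`s = sqrt (1 - 4 X)` with constant term `c`. -/
def HasLead (f : ℝ⟦X⟧) (κ : ℕ) (c : ℝ) : Prop :=
  ∃ (N : ℕ) (p : Polynomial ℝ), (4 * X) ^ N * f * sqrtSeries ^ κ = Polynomial.aeval sqrtSeries p ∧
    p.eval 0 = c

theorem HasLead.mul {f g : ℝ⟦X⟧} {κ μ : ℕ} {c d : ℝ} (hf : HasLead f κ c) (hg : HasLead g μ d) :
    HasLead (f * g) (κ + μ) (c * d) := by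
  obtain ⟨N, p, h1, rfl⟩ := hf
  obtain ⟨M, q, h2, rfl⟩ := hg
  refine ⟨N + M, p * q, ?_, by simp⟩
  rw [map_mul, ← h1, ← h2]
  ring

/-- Since `4X = 1 - s ^ 2` takes the value 1 at `s = 0`, multiplying by its powers does not change
the leading coefficient. -/
theorem aeval_one_sub_sq (N : ℕ) :
    Polynomial.aeval sqrtSeries ((1 - Polynomial.X ^ 2 : Polynomial ℝ) ^ N) = (4 * X) ^ N := by
  simp [sqrtSeries_sq]

theorem HasLead.add {f g : ℝ⟦X⟧} {κ : ℕ} {c d : ℝ} (hf : HasLead f κ c) (hg : HasLead g κ d) :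
    HasLead (f + g) κ (c + d) := by
  obtain ⟨N, p, h1, rfl⟩ := hf
  obtain ⟨M, q, h2, rfl⟩ := hg
  refine ⟨N + M, (1 - Polynomial.X ^ 2) ^ M * p + (1 - Polynomial.X ^ 2) ^ N * q, ?_, by simp⟩
  rw [map_add, map_mul, map_mul, aeval_one_sub_sq, aeval_one_sub_sq, ← h1, ← h2]
  ring

theorem hasLead_zero (κ : ℕ) : HasLead 0 κ 0 := ⟨0, 0, by simp, by simp⟩

theorem HasLead.sum {ι : Type*} {t : Finset ι} {f : ι → ℝ⟦X⟧} {κ : ℕ} {c : ι → ℝ}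
    (h : ∀ i ∈ t, HasLead (f i) κ (c i)) : HasLead (∑ i ∈ t, f i) κ (∑ i ∈ t, c i) := by
  classical
  induction t using Finset.induction_on with
  | empty => simpa using hasLead_zero κ
  | insert a t ha ih =>
    rw [Finset.sum_insert ha, Finset.sum_insert ha]
    exact (h a (by simp)).add (ih fun i hi => h i (by simp [hi]))

theorem HasLead.of_sqrtSeries_mul {f : ℝ⟦X⟧} {κ : ℕ} {c : ℝ} (h : HasLead (sqrtSeries * f) κ c) :
    HasLead f (κ + 1) c := by
  obtain ⟨N, p, h1, rfl⟩ := h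
  refine ⟨N, p, ?_, rfl⟩
  rw [← h1]
  ring

/-- Lets a term of lower order be added to a dominant one. -/
theorem HasLead.succ {f : ℝ⟦X⟧} {κ : ℕ} {c : ℝ} (h : HasLead f κ c) : HasLead f (κ + 1) 0 := by
  obtain ⟨N, p, h1, rfl⟩ := h
  refine ⟨N, p * Polynomial.X, ?_, by simp⟩
  rw [map_mul, ← h1, Polynomial.aeval_X]
  ring

theorem hasLead_X : HasLead X 0 (1 / 4) := by
  refine ⟨1, Polynomial.C (1 / 4) * (1 - Polynomial.X ^ 2) ^ 2, ?_, by simp⟩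
  rw [map_mul, aeval_one_sub_sq, Polynomial.aeval_C, PowerSeries.algebraMap_apply]
  have : (C (4⁻¹ : ℝ) : ℝ⟦X⟧) * 4 = 1 := by
    rw [show (4 : ℝ⟦X⟧) = C 4 from rfl, ← map_mul]; norm_num
  simp
  linear_combination (-4 * X ^ 2) * this

theorem two_mul_catalanTreeSeries : 2 * catalanTreeSeries = 1 - sqrtSeries := by
  rw [sqrtSeries]; ring

theorem hasLead_catalanTreeSeries : HasLead catalanTreeSeries 0 (1 / 2) := by
  refine ⟨0, Polynomial.C (1 / 2) * (1 - Polynomial.X), ?_, by simp⟩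
  have : (C (2⁻¹ : ℝ) : ℝ⟦X⟧) * 2 = 1 := by
    rw [show (2 : ℝ⟦X⟧) = C 2 from rfl, ← map_mul]; norm_num
  rw [map_mul, Polynomial.aeval_C, PowerSeries.algebraMap_apply, map_sub, map_one, Polynomial.aeval_X,
    ← two_mul_catalanTreeSeries]
  simp
  linear_combination (-catalanTreeSeries) * this

theorem hasLead_forestSeries_nil : HasLead (forestSeries []) 0 2 := by
  -- `X * forestSeries [] = (1 - s) / 2`, hence one factor `4X` is needed.
  refine ⟨1, 2 * (1 - Polynomial.X), ?_, by simp⟩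
  rw [map_mul, map_sub, map_one, Polynomial.aeval_X, ← two_mul_catalanTreeSeries, map_ofNat]
  linear_combination -4 * catalanTreeSeries_eq

/-- The monomial of degree `j` contributes `(1 - 4X) ^ (-(κ - j) / 2)`, whose coefficients are
smaller than the main scale by `n ^ (-j / 2)`; only `j = 0` survives. For `κ = 0` the limit is 0. -/
theorem HasLead.tendsto_coeff {f : ℝ⟦X⟧} {κ : ℕ} {c : ℝ} (h : HasLead f κ c) :
    Tendsto (fun n : ℕ => coeff n f / (4 ^ n * (n : ℝ) ^ ((κ : ℝ) / 2 - 1))) atTop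
      (𝓝 (c * (Real.Gamma (κ / 2))⁻¹)) := by
  obtain ⟨N, p, h1, rfl⟩ := h
  have h2 : (4 * X) ^ N * f =
      ∑ j ∈ Finset.range (p.natDegree + 1), C (p.coeff j) * powSeries (-(((κ : ℝ) - j) / 2)) := by
    have h3 : sqrtSeries ^ κ * powSeries (-((κ : ℝ) / 2)) = 1 := by
      rw [sqrtSeries_eq_powSeries, ← powSeries_nat_mul, ← powSeries_add, ← powSeries_zero]
      ring_nf
    calc (4 * X) ^ N * f = (4 * X) ^ N * f * sqrtSeries ^ κ * powSeries (-((κ : ℝ) / 2)) := by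
          rw [mul_assoc _ (sqrtSeries ^ κ), h3, mul_one]
      _ = _ := by
          rw [h1, Polynomial.aeval_eq_sum_range, Finset.sum_mul]
          refine Finset.sum_congr rfl fun j _ => ?_
          rw [smul_eq_C_mul, mul_assoc, sqrtSeries_eq_powSeries, ← powSeries_nat_mul,
            ← powSeries_add]
          ring_nf
  have h3 : ∀ n, coeff (n + N) ((4 * X) ^ N * f) = 4 ^ N * coeff n f := by
    intro n
    rw [mul_pow, mul_assoc, show (4 : ℝ⟦X⟧) ^ N = C (4 ^ N) by rw [map_pow]; rfl, coeff_C_mul,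
      coeff_X_pow_mul]
  have h4 : Tendsto (fun m : ℕ => coeff m ((4 * X) ^ N * f) /
      (4 ^ m * (m : ℝ) ^ ((κ : ℝ) / 2 - 1))) atTop (𝓝 (p.eval 0 * (Real.Gamma (κ / 2))⁻¹)) := by
    have h5 : ∀ j ∈ Finset.range (p.natDegree + 1), Tendsto (fun m : ℕ =>
        p.coeff j * (coeff m (powSeries (-(((κ : ℝ) - j) / 2))) /
          (4 ^ m * (m : ℝ) ^ ((κ : ℝ) / 2 - 1)))) atTop
        (𝓝 (if j = 0 then p.eval 0 * (Real.Gamma (κ / 2))⁻¹ else 0)) := by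
      intro j _
      have h6 := tendsto_coeff_powSeries (((κ : ℝ) - j) / 2)
      split_ifs with hj
      · subst hj
        rw [← Polynomial.coeff_zero_eq_eval_zero]
        simpa using h6.const_mul (p.coeff 0)
      · have hj' : (0 : ℝ) < j / 2 := by positivity
        have h7 := (tendsto_rpow_neg_atTop hj').comp (tendsto_natCast_atTop_atTop (R := ℝ))
        have h8 := (h6.mul h7).const_mul (p.coeff j)
        rw [mul_zero, mul_zero] at h8
        refine h8.congr' ?_
        filter_upwards [eventually_gt_atTop 0] with m hm
        have hm' : (0 : ℝ) < m := Nat.cast_pos.2 hm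
        rw [Function.comp_apply, show (κ : ℝ) / 2 - 1 = ((κ : ℝ) - j) / 2 - 1 + j / 2 by ring,
          Real.rpow_add hm', Real.rpow_neg hm'.le]
        field_simp
    have h6 := tendsto_finsetSum _ h5
    rw [Finset.sum_ite_eq'] at h6
    simp only [Finset.mem_range, Nat.succ_pos, if_true] at h6
    refine h6.congr fun m => ?_
    rw [h2, map_sum, Finset.sum_div]
    refine Finset.sum_congr rfl fun j _ => ?_
    rw [coeff_C_mul, mul_div_assoc]
  -- The factor `(4X) ^ N` shifts the index by `N` and multiplies by `4 ^ N`, so only the ratio of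
  -- the powers of `n` and `n + N` is left to correct.
  have h5 := h4.comp (tendsto_add_atTop_nat N)
  have h6 : Tendsto (fun n : ℕ => (((n : ℝ) / (n + N)) ^ ((κ : ℝ) / 2 - 1))⁻¹) atTop (𝓝 1) := by
    have := ((tendsto_natCast_div_add_atTop (N : ℝ)).rpow_const (p := (κ : ℝ) / 2 - 1)
      (Or.inl one_ne_zero)).inv₀ (by simp)
    simpa using this
  have h7 := h5.mul h6
  rw [mul_one] at h7
  refine h7.congr' ?_
  filter_upwards [eventually_gt_atTop 0] with n hn
  have hn' : (0 : ℝ) < n := Nat.cast_pos.2 hn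
  have h8 : (0 : ℝ) < n + N := by positivity
  have h9 := (Real.rpow_pos_of_pos hn' ((κ : ℝ) / 2 - 1)).ne'
  have h10 := (Real.rpow_pos_of_pos h8 ((κ : ℝ) / 2 - 1)).ne'
  rw [Function.comp_apply, h3, Real.div_rpow hn'.le h8.le, Nat.cast_add, pow_add]
  field_simp

/-! ### The constant and the exponent, computed recursively. -/

theorem degreeCount_node (i : ℕ) (L : List PlaneTree) : (node L).degreeCount i =
    (if L.length = i then 1 else 0) + (L.map (degreeCount i)).sum := by
  rw [degreeCount]

theorem size_le_forestSize {t : PlaneTree} {L : List PlaneTree} (h : t ∈ L) :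
    t.size ≤ forestSize L :=
  List.single_le_sum (by simp) _ (List.mem_map_of_mem h)

theorem length_le_forestSize (L : List PlaneTree) : L.length ≤ forestSize L := by
  induction L with
  | nil => simp
  | cons t L ih =>
    have := size_pos t
    simp
    omega

theorem degreeCount_eq_zero : ∀ (T : PlaneTree) {i : ℕ}, T.size ≤ i → T.degreeCount i = 0
  | node L, i, h => by
    rw [size_node] at h
    have := length_le_forestSize L
    rw [degreeCount_node, if_neg (by omega), zero_add, List.sum_eq_zero_iff]
    intro x hx
    obtain ⟨t, ht, rfl⟩ := List.mem_map.1 hx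
    have := size_le_forestSize ht
    exact degreeCount_eq_zero t (by omega)
termination_by T => sizeOf T
decreasing_by
  have := List.sizeOf_lt_of_mem ht
  simp only [node.sizeOf_spec]
  omega

theorem degreeCount_zero_pos : ∀ T : PlaneTree, 0 < T.degreeCount 0
  | node [] => by simp [degreeCount_node]
  | node (t :: L) => by
    have := degreeCount_zero_pos t
    simp [degreeCount_node]
    omega

/-- The contribution of a vertex with `i` children to the constant `catalanConst`. -/
def degreeWeight (i : ℕ) : ℕ := if i = 0 then 1 else catalan (i - 1)

/-- An index range common to a tree and its subtrees makes the product multiplicative over subtrees.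
The added factors are 1, by weight at `i = 0` and by exponent at `i ≥ S.size`. -/
theorem catalanConst_eq_prod_range {S : PlaneTree} {N : ℕ} (hN : S.size ≤ N) :
    S.catalanConst = ∏ i ∈ Finset.range N, degreeWeight i ^ S.degreeCount i := by
  have h : S.catalanConst = ∏ i ∈ Finset.Icc 1 (S.size - 1), degreeWeight i ^ S.degreeCount i := by
    refine Finset.prod_congr rfl fun i hi => ?_
    rw [degreeWeight, if_neg (by simp at hi; omega)]
  rw [h]
  refine Finset.prod_subset (fun i hi => ?_) fun i _ hi => ?_
  · have := size_pos S
    simp at hi ⊢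
    omega
  · rcases Nat.eq_zero_or_pos i with rfl | h0
    · simp [degreeWeight]
    · rw [degreeCount_eq_zero S (by simp at hi; omega), pow_zero]

theorem catalanConst_node (L : List PlaneTree) :
    (node L).catalanConst = degreeWeight L.length * (L.map catalanConst).prod := by
  rw [catalanConst_eq_prod_range le_rfl]
  simp only [degreeCount_node, pow_add, Finset.prod_mul_distrib]
  congr 1
  · have : L.length < (node L).size := by
      have := length_le_forestSize L
      rw [size_node]
      omega
    simp only [pow_ite, pow_one, pow_zero]
    rw [Finset.prod_ite_eq, if_pos (by simpa using this)]
  · have : ∀ L' : List PlaneTree, forestSize L' ≤ (node L).size →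
        ∏ i ∈ Finset.range (node L).size, degreeWeight i ^ (L'.map (degreeCount i)).sum =
          (L'.map catalanConst).prod := by
      intro L' hL'
      induction L' with
      | nil => simp
      | cons t L' ih =>
        rw [forestSize_cons] at hL'
        simp only [List.map_cons, List.sum_cons, List.prod_cons, pow_add, Finset.prod_mul_distrib]
        rw [ih (by omega), ← catalanConst_eq_prod_range (by omega)]
    exact this L (by rw [size_node]; omega)

theorem catalanConst_pos (S : PlaneTree) : 0 < S.catalanConst := by
  refine Finset.prod_pos fun i _ => pow_pos ?_ _
  have h := succ_mul_catalan_eq_centralBinom (i - 1)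
  have := Nat.centralBinom_pos (i - 1)
  exact Nat.pos_of_ne_zero fun h0 => by simp [h0] at h; omega

/-- The number of vertices plus the number of leaves. -/
def order (S : PlaneTree) : ℕ := S.size + S.degreeCount 0

/-- The sum of the numbers of vertices and of leaves of a forest. -/
def forestOrder (L : List PlaneTree) : ℕ := (L.map order).sum

/-- The leading coefficient of the generating function of the embeddings of `S`. -/
noncomputable def weight (S : PlaneTree) : ℝ := S.catalanConst * (1 / 2) ^ S.order

/-- The leading coefficient of the generating function of the embeddings of a nonempty forest. -/
noncomputable def forestWeight (L : List PlaneTree) : ℝ :=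
  catalan (L.length - 1) * (L.map weight).prod

theorem forestOrder_append (L L' : List PlaneTree) :
    forestOrder (L ++ L') = forestOrder L + forestOrder L' := by simp [forestOrder]

theorem order_node {L : List PlaneTree} (hL : L ≠ []) :
    (node L).order = 1 + forestOrder L := by
  have h : ∀ L : List PlaneTree,
      forestOrder L = forestSize L + (L.map (degreeCount 0)).sum := by
    intro L
    induction L with
    | nil => rfl
    | cons t L ih =>
      rw [forestOrder, List.map_cons, List.sum_cons, ← forestOrder, ih, order, forestSize_cons,
        List.map_cons, List.sum_cons]
      omega
  rw [order, size_node, degreeCount_node, if_neg (by simpa using hL), h]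
  omega

theorem order_node_nil : (node []).order = 2 := by
  simp [order, size_node, degreeCount_node]

theorem weight_node_nil : (node []).weight = 1 / 4 := by
  rw [weight, order_node_nil, catalanConst_node]
  norm_num [degreeWeight]

theorem weight_node {L : List PlaneTree} (hL : L ≠ []) :
    2 * (node L).weight = forestWeight L := by
  have h : ∀ L : List PlaneTree,
      (L.map weight).prod = ((L.map catalanConst).prod : ℕ) * (1 / 2) ^ forestOrder L := by
    intro L
    induction L with
    | nil => simp [forestOrder]
    | cons t L ih =>
      rw [List.map_cons, List.prod_cons, ih, weight, List.map_cons, List.prod_cons,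
        show forestOrder (t :: L) = t.order + forestOrder L by simp [forestOrder], pow_add]
      push_cast
      ring
  rw [weight, order_node hL, catalanConst_node, forestWeight, h, degreeWeight,
    if_neg (by simpa using hL), pow_add]
  push_cast
  ring

/-- The product of the tree weights is the same for every cut, so this is the Catalan recurrence. -/
theorem forestWeight_eq_sum {L : List PlaneTree} {n : ℕ} (hL : L.length = n + 2) :
    forestWeight L = ∑ k ∈ Finset.range (n + 1),
      forestWeight (L.take (k + 1)) * forestWeight (L.drop (k + 1)) := by
  have h : ∀ k ∈ Finset.range (n + 1), forestWeight (L.take (k + 1)) *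
      forestWeight (L.drop (k + 1)) = (catalan k * catalan (n - k) : ℕ) * (L.map weight).prod := by
    intro k hk
    rw [Finset.mem_range] at hk
    have h1 : (L.map weight).prod =
        ((L.take (k + 1)).map weight).prod * ((L.drop (k + 1)).map weight).prod := by
      rw [← List.prod_append, ← List.map_append, List.take_append_drop]
    rw [forestWeight, forestWeight, h1, List.length_take, List.length_drop, hL,
      show min (k + 1) (n + 2) - 1 = k by omega, show n + 2 - (k + 1) - 1 = n - k by omega]
    push_cast
    ring
  rw [Finset.sum_congr rfl h, ← Finset.sum_mul, ← Nat.cast_sum, forestWeight, hL,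
    show n + 2 - 1 = n + 1 by omega, catalan_succ',
    Finset.Nat.sum_antidiagonal_eq_sum_range_succ fun i j => catalan i * catalan j]

/-! ### Leading terms of all generating functions, by induction on the forest. -/

theorem hasLead_of_forest (L : List PlaneTree) (h : L ≠ [] → ∃ κ, κ + 1 = forestOrder L ∧
    HasLead (forestSeries L) κ (4 * forestWeight L)) :
    ∃ κ, κ + 2 = (node L).order ∧ HasLead (forestSeries L) κ (8 * (node L).weight) := by
  rcases eq_or_ne L [] with rfl | hL
  · refine ⟨0, order_node_nil.symm, ?_⟩
    rw [weight_node_nil]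
    convert hasLead_forestSeries_nil using 1
    norm_num
  · obtain ⟨κ, h1, h2⟩ := h hL
    refine ⟨κ, by rw [order_node hL]; omega, ?_⟩
    convert h2 using 1
    rw [← weight_node hL]
    ring

/-- The ratio 4 between the coefficients comes from `treeSeries L ≈ X * forestSeries L` with `X = 1
/ 4` at `s = 0`. A cut adds the exponents of its parts to `forestOrder L - 2`, and dividing by `s`
raises this by one. -/
theorem hasLead_forest (N : ℕ) : ∀ L : List PlaneTree, forestSize L ≤ N → L ≠ [] →
    ∃ κ, κ + 1 = forestOrder L ∧ HasLead (forestSeries L) κ (4 * forestWeight L) ∧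
      HasLead (treeSeries L) κ (forestWeight L) := by
  induction N with
  | zero =>
    intro L h hL
    exact absurd (eq_nil_of_forestSize (by omega)) hL
  | succ N ih =>
    intro L hN hL
    rcases L with _ | ⟨⟨L'⟩, _ | ⟨t, L⟩⟩
    · exact absurd rfl hL
    · obtain ⟨κ, h1, h2⟩ := hasLead_of_forest L' fun hL' => by
        rw [forestSize_cons, size_node] at hN
        obtain ⟨κ, h1, h2, -⟩ := ih L' (by omega) hL'
        exact ⟨κ, h1, h2⟩
      have hw : forestWeight [node L'] = (node L').weight := by simp [forestWeight]
      have h3 : HasLead (forestSeries [node L']) (κ + 1) (4 * (node L').weight) := by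
        refine HasLead.of_sqrtSeries_mul ?_
        rw [sqrtSeries_mul_forestSeries_singleton]
        convert hasLead_catalanTreeSeries.mul h2 using 1
        · omega
        · ring
      refine ⟨κ + 1, by simp [forestOrder]; omega, by rwa [hw], ?_⟩
      rw [treeSeries_singleton, hw]
      -- Embeddings using the root of the host are of lower order by one factor `s`.
      convert hasLead_X.mul (h3.add h2.succ) using 1
      · omega
      · ring
    · generalize hL₀ : node L' :: t :: L = L₀ at *
      obtain ⟨n, hn⟩ : ∃ n, L₀.length = n + 2 := ⟨L.length, by simp [← hL₀]⟩
      have hpos : 2 ≤ forestOrder L₀ := by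
        rw [← hL₀]
        have := size_pos (node L')
        have := size_pos t
        simp [forestOrder, order]
        omega
      have key : HasLead (sqrtSeries * forestSeries L₀) (forestOrder L₀ - 2)
          (4 * forestWeight L₀) := by
        rw [sqrtSeries_mul_forestSeries hn, forestWeight_eq_sum hn, Finset.mul_sum]
        refine HasLead.sum fun k hk => ?_
        rw [Finset.mem_range] at hk
        have hs := forestSize_append (L₀.take (k + 1)) (L₀.drop (k + 1))
        have ho := forestOrder_append (L₀.take (k + 1)) (L₀.drop (k + 1))
        rw [List.take_append_drop] at hs ho
        have h1 : L₀.take (k + 1) ≠ [] := by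
          intro h
          have := congrArg List.length h
          simp [hn] at this
        have h2 : L₀.drop (k + 1) ≠ [] := by
          intro h
          have := congrArg List.length h
          simp [hn] at this
          omega
        have h3 : 0 < forestSize (L₀.take (k + 1)) :=
          Nat.pos_of_ne_zero fun h => h1 (eq_nil_of_forestSize h)
        have h4 : 0 < forestSize (L₀.drop (k + 1)) :=
          Nat.pos_of_ne_zero fun h => h2 (eq_nil_of_forestSize h)
        obtain ⟨κ, h5, -, h6⟩ := ih _ (by omega) h1
        obtain ⟨μ, h7, h8, -⟩ := ih _ (by omega) h2
        convert h6.mul h8 using 1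
        · omega
        · ring
      refine ⟨forestOrder L₀ - 2 + 1, by omega, key.of_sqrtSeries_mul, ?_⟩
      rw [treeSeries_of_length_ne_one (by omega)]
      convert hasLead_X.mul key.of_sqrtSeries_mul using 1
      · omega
      · ring

theorem hasLead_totalEmb (S : PlaneTree) :
    ∃ κ, κ + 1 = S.order ∧ HasLead (treeSeries [S]) κ S.weight := by
  obtain ⟨κ, h1, -, h2⟩ := hasLead_forest _ [S] le_rfl (by simp)
  exact ⟨κ, by simpa [forestOrder] using h1, by simpa [forestWeight] using h2⟩

theorem hasLead_totalGoodEmb (L : List PlaneTree) :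
    ∃ κ, κ + 2 = (node L).order ∧ HasLead (X * forestSeries L) κ (2 * (node L).weight) := by
  obtain ⟨κ, h1, h2⟩ := hasLead_of_forest L fun hL => by
    obtain ⟨κ, h1, h2, -⟩ := hasLead_forest _ L le_rfl hL
    exact ⟨κ, h1, h2⟩
  refine ⟨κ, h1, ?_⟩
  convert hasLead_X.mul h2 using 1
  · omega
  · ring

/-! ### Asymptotic equivalences for the total counts. -/

theorem HasLead.isEquivalent {f : ℝ⟦X⟧} {κ : ℕ} {c : ℝ} (h : HasLead f κ c) (hκ : 0 < κ)
    (hc : c ≠ 0) : (fun n => coeff n f) ~[atTop] fun n : ℕ =>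
      c / Real.Gamma (κ / 2) * 4 ^ n * (n : ℝ) ^ ((κ : ℝ) / 2 - 1) := by
  refine isEquivalent_of_tendsto_div ?_ h.tendsto_coeff
  have : 0 < Real.Gamma (κ / 2) := Real.Gamma_pos_of_pos (by positivity)
  positivity

theorem weight_pos (S : PlaneTree) : 0 < S.weight := by
  have := catalanConst_pos S
  rw [weight]
  positivity

theorem totalEmb_isEquivalent (S : PlaneTree) :
    (fun n => (S.totalEmb n : ℝ)) ~[atTop] fun n : ℕ =>
      S.weight / Real.Gamma (((S.order : ℝ) - 1) / 2) * 4 ^ n *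
        (n : ℝ) ^ (((S.order : ℝ) - 3) / 2) := by
  obtain ⟨κ, h1, h2⟩ := hasLead_totalEmb S
  have hκ : 0 < κ := by
    have := size_pos S
    have := degreeCount_zero_pos S
    rw [order] at h1
    omega
  have h3 := h2.isEquivalent hκ (weight_pos S).ne'
  simp only [coeff_treeSeries_singleton] at h3
  rw [← h1]
  convert h3 using 5 <;> push_cast <;> ring_nf

theorem totalGoodEmb_isEquivalent {S : PlaneTree} (hS : 2 ≤ S.size) :
    (fun n => (S.totalGoodEmb n : ℝ)) ~[atTop] fun n : ℕ =>
      2 * S.weight / Real.Gamma (((S.order : ℝ) - 2) / 2) * 4 ^ n *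
        (n : ℝ) ^ (((S.order : ℝ) - 4) / 2) := by
  obtain ⟨L⟩ := S
  obtain ⟨κ, h1, h2⟩ := hasLead_totalGoodEmb L
  -- Two vertices and a leaf give order at least 3. For a single vertex `κ = 0`, and the leading
  -- term would give no information.
  have hκ : 0 < κ := by
    have := degreeCount_zero_pos (node L)
    rw [order] at h1
    omega
  have h3 := h2.isEquivalent hκ (mul_pos two_pos (weight_pos _)).ne'
  simp only [coeff_X_mul_forestSeries] at h3
  rw [← h1]
  convert h3 using 5 <;> push_cast <;> ring_nf

theorem coeff_catalanTreeSeries {n : ℕ} (hn : n ≠ 0) :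
    coeff n catalanTreeSeries = -(1 / 2) * coeff n (powSeries (1 / 2)) := by
  have h := congrArg (coeff n) two_mul_catalanTreeSeries
  rw [map_sub, coeff_one, if_neg hn, sqrtSeries_eq_powSeries, show (2 : ℝ⟦X⟧) = C 2 from rfl,
    coeff_C_mul] at h
  linear_combination h / 2

theorem Gamma_neg_one_half : Real.Gamma (-(1 / 2)) = -2 * Real.sqrt Real.pi := by
  have h := Real.Gamma_add_one (s := -(1 / 2)) (by norm_num)
  rw [show (-(1 / 2) : ℝ) + 1 = 1 / 2 by norm_num, Real.Gamma_one_half_eq] at h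
  linarith

/-- Here the series is `(1 - s) / 2`, so the growth comes from `-s / 2`, with `Gamma (-1/2) = -2
√π`. -/
theorem totalGoodEmb_single_isEquivalent :
    (fun n => ((node []).totalGoodEmb n : ℝ)) ~[atTop] fun n : ℕ =>
      1 / (4 * Real.sqrt Real.pi) * 4 ^ n * (n : ℝ) ^ (-(3 / 2) : ℝ) := by
  have hpi : 0 < Real.sqrt Real.pi := Real.sqrt_pos.2 Real.pi_pos
  refine isEquivalent_of_tendsto_div (by positivity) ?_
  have h := (tendsto_coeff_powSeries (-(1 / 2))).const_mul (-(1 / 2))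
  rw [Gamma_neg_one_half] at h
  have h1 : -(1 / 2) * (-2 * Real.sqrt Real.pi)⁻¹ = 1 / (4 * Real.sqrt Real.pi) := by
    field_simp
    norm_num
  rw [h1] at h
  refine h.congr' ?_
  filter_upwards [eventually_ne_atTop 0] with n hn
  rw [← coeff_X_mul_forestSeries, ← catalanTreeSeries_eq, coeff_catalanTreeSeries hn, neg_neg,
    show (-(1 / 2) - 1 : ℝ) = -(3 / 2) by norm_num, mul_div_assoc]

theorem eq_node_nil_of_size {S : PlaneTree} (h : S.size = 1) : S = node [] := by
  obtain ⟨L⟩ := S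
  rw [size_node] at h
  rw [eq_nil_of_forestSize (L := L) (by omega)]

end PlaneTree

theorem mainTheorem6 (S : PlaneTree) (m l : ℕ) (hm : m = S.size) (hl : l = S.degreeCount 0) :
    ((fun n : ℕ => (S.totalEmb n : ℝ)) ~[atTop]
      fun n : ℕ => (S.catalanConst : ℝ) * (1 / 2 : ℝ) ^ (m + l) / Real.Gamma (((m : ℝ) + l - 1) / 2)
        * 4 ^ n * (n : ℝ) ^ (((m : ℝ) + l - 3) / 2)) ∧
    (2 ≤ m →
      (fun n : ℕ => (S.totalGoodEmb n : ℝ)) ~[atTop]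
        fun n : ℕ => 2 * (S.catalanConst : ℝ) * (1 / 2 : ℝ) ^ (m + l)
          / Real.Gamma (((m : ℝ) + l - 2) / 2) * 4 ^ n * (n : ℝ) ^ (((m : ℝ) + l - 4) / 2)) ∧
    (m = 1 →
      (fun n : ℕ => (S.totalGoodEmb n : ℝ)) ~[atTop]
        fun n : ℕ => 1 / (4 * Real.sqrt Real.pi) * 4 ^ n * (n : ℝ) ^ (-(3 / 2) : ℝ)) := by
  subst hm hl
  have ho : (S.order : ℝ) = (S.size : ℝ) + S.degreeCount 0 := by
    rw [PlaneTree.order]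
    push_cast
    rfl
  refine ⟨?_, fun h => ?_, fun h => ?_⟩
  · have := S.totalEmb_isEquivalent
    rwa [ho, PlaneTree.weight, PlaneTree.order] at this
  · have := PlaneTree.totalGoodEmb_isEquivalent h
    rwa [ho, PlaneTree.weight, PlaneTree.order, ← mul_assoc] at this
  · rw [PlaneTree.eq_node_nil_of_size h]
    exact PlaneTree.totalGoodEmb_single_isEquivalent
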